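/- Let $H$ be a complex Hilbert space of dimension two, let $a, b \in \mathcal{B}(H)$, and let $T_{a,b} \colon \mathcal{B}(H) \to \mathcal{B}(H)$ be the linear operator $T_{a,b}(x) = axb + bxa$. Then $T_{a,b}$ is completely bounded and \[ \|T_{a,b}\|_{cb} \geq \|a\|_2 \, \|b\|_2 . \] Here $\|a\|_2 = (\operatorname{trace} a^*a)^{1/2}$ is the Hilbert--Schmidt norm, $\|T\|_{cb} = \sup_{n \geq 1} \|T_n\|$ is the completely bounded norm, where $T_n \colon M_n(\mathcal{B}(H)) \to M_n(\mathcal{B}(H))$ applies $T$ to every matrix entry and $M_n(\mathcal{B}(H))$ carries the operator norm of $\mathcal{B}(H^n)$, and $T$ is completely bounded if $\|T\|_{cb} < \infty$. -/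

import Mathlib

/-- The completely bounded norm of a linear map `T : A → B` of C⋆-algebras, as an extended
nonnegative real: the supremum over `n` of the operator norms of the amplifications
`T_n : M_n(A) → M_n(B)`, `(x i j) ↦ (T (x i j))`. Here `M_n(A)` is Mathlib's
`CStarMatrix (Fin n) (Fin n) A`, the `n × n` matrices with their unique C⋆-norm; for
`A = 𝓑(H)` this is the operator norm on `𝓑(Hⁿ)`. -/
noncomputable def cbENorm {A B : Type*}
    [NonUnitalCStarAlgebra A] [PartialOrder A] [StarOrderedRing A]
    [NonUnitalCStarAlgebra B] [PartialOrder B] [StarOrderedRing B]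
    (T : A →ₗ[ℂ] B) : ENNReal :=
  ⨆ (n : ℕ) (x : CStarMatrix (Fin n) (Fin n) A) (_ : ‖x‖ ≤ 1), ENNReal.ofReal ‖x.map T‖

/-- `T` is completely bounded if its CB norm is finite. -/
def IsCompletelyBounded {A B : Type*}
    [NonUnitalCStarAlgebra A] [PartialOrder A] [StarOrderedRing A]
    [NonUnitalCStarAlgebra B] [PartialOrder B] [StarOrderedRing B]
    (T : A →ₗ[ℂ] B) : Prop :=
  cbENorm T ≠ ⊤

/-- The CB norm `‖T‖_cb` as a real number (meaningful for completely bounded `T`). -/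
noncomputable def cbNorm {A B : Type*}
    [NonUnitalCStarAlgebra A] [PartialOrder A] [StarOrderedRing A]
    [NonUnitalCStarAlgebra B] [PartialOrder B] [StarOrderedRing B]
    (T : A →ₗ[ℂ] B) : ℝ :=
  (cbENorm T).toReal

/-- The elementary operator `T_{a,b} : x ↦ a x b + b x a` on `𝓑(H)`. -/
def jordanElementary {H : Type*} [NormedAddCommGroup H] [InnerProductSpace ℂ H]
    (a b : H →L[ℂ] H) : (H →L[ℂ] H) →ₗ[ℂ] (H →L[ℂ] H) where
  toFun x := a * x * b + b * x * a
  map_add' x y := by simp only [mul_add, add_mul]; abel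
  map_smul' c x := by simp only [mul_smul_comm, smul_mul_assoc, smul_add, RingHom.id_apply]

/-- The Hilbert–Schmidt norm `‖a‖₂ = (trace (a⋆ a))^(1/2)` of an operator on a
finite-dimensional Hilbert space (`star a` is the adjoint of `a`; the trace is a nonnegative
real number). -/
noncomputable def hilbertSchmidtNorm {H : Type*} [NormedAddCommGroup H] [InnerProductSpace ℂ H]
    [CompleteSpace H] (a : H →L[ℂ] H) : ℝ :=
  Real.sqrt (LinearMap.trace ℂ H ((star a * a : H →L[ℂ] H) : H →ₗ[ℂ] H)).re

/-! Let `n = dim H`, view `M_n(𝓑(H))` as the operators on `Hⁿ`, and send `a` to the vector `ξ_a = (a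
eᵢ)ᵢ`, so that `⟪ξ_a, ξ_b⟫ = trace (a⋆ b)`. For an operator `X` on `Hⁿ`, the coefficient of `T_n(X)`
at `ξ_1` is `⟪ξ_{a⋆}, X ξ_b⟫ + ⟪ξ_{b⋆}, X ξ_a⟫`. Cyclicity of the trace makes the pairs `ξ_a, ξ_b`
and `ξ_{b⋆}, ξ_{a⋆}` have equal Gram matrices. Hence, up to scalars, one contraction `X` carries
`ξ_b` to `ξ_{a⋆}` and `ξ_a` to `ξ_{b⋆}`, and both terms are maximal with a common phase: the modulus
is `2 ‖a‖₂ ‖b‖₂`. Since `‖ξ_1‖² = n`, this gives `2 ‖a‖₂ ‖b‖₂ ≤ n ‖T_n(X)‖`, and for `n = 2` the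
factors cancel. -/

open scoped InnerProductSpace InnerProduct

/-! ### Matrices over `𝓑(H)` as operators on `Hⁿ`; complete boundedness -/

section CStarMatrixRepresentation

variable {H ι : Type*} [NormedAddCommGroup H] [InnerProductSpace ℂ H] [Fintype ι]

/-- The operator on the Hilbert sum `Hⁿ` given by a matrix of operators on `H`. -/
noncomputable def matrixOperator (M : CStarMatrix ι ι (H →L[ℂ] H)) :
    PiLp 2 (fun _ : ι => H) →L[ℂ] PiLp 2 (fun _ : ι => H) :=
  (PiLp.continuousLinearEquiv 2 ℂ (fun _ : ι => H)).symm.toContinuousLinearMap ∘L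
    ContinuousLinearMap.pi fun i => ∑ j, M i j ∘L PiLp.proj 2 (fun _ : ι => H) j

@[simp]
lemma matrixOperator_apply (M : CStarMatrix ι ι (H →L[ℂ] H)) (x : PiLp 2 (fun _ : ι => H))
    (i : ι) : matrixOperator M x i = ∑ j, M i j (x j) := by
  simp [matrixOperator]

/-- Block-diagonal amplification `a ⊗ 1` of an operator on `H`. -/
noncomputable def diagonalOperator (ι : Type*) [Fintype ι] (a : H →L[ℂ] H) :
    PiLp 2 (fun _ : ι => H) →L[ℂ] PiLp 2 (fun _ : ι => H) :=
  (PiLp.continuousLinearEquiv 2 ℂ (fun _ : ι => H)).symm.toContinuousLinearMap ∘L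
    ContinuousLinearMap.pi fun i => a ∘L PiLp.proj 2 (fun _ : ι => H) i

@[simp]
lemma diagonalOperator_apply (a : H →L[ℂ] H) (x : PiLp 2 (fun _ : ι => H)) (i : ι) :
    diagonalOperator ι a x i = a (x i) := by
  simp [diagonalOperator]

lemma matrixOperator_injective [DecidableEq ι] :
    Function.Injective (matrixOperator : CStarMatrix ι ι (H →L[ℂ] H) → _) := by
  intro M N h
  ext i j x
  have := congrArg (fun T => T (PiLp.single 2 j x) i) h
  simpa [Pi.single_apply, apply_ite] using this

/-- The matrix of blocks of an operator on the Hilbert sum `Hⁿ`. -/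
noncomputable def operatorBlocks [DecidableEq ι]
    (X : PiLp 2 (fun _ : ι => H) →L[ℂ] PiLp 2 (fun _ : ι => H)) :
    CStarMatrix ι ι (H →L[ℂ] H) :=
  CStarMatrix.ofMatrix fun i j =>
    PiLp.proj 2 (fun _ : ι => H) i ∘L X ∘L
      (PiLp.continuousLinearEquiv 2 ℂ (fun _ : ι => H)).symm.toContinuousLinearMap ∘L
        ContinuousLinearMap.single ℂ (fun _ : ι => H) j

lemma matrixOperator_operatorBlocks [DecidableEq ι]
    (X : PiLp 2 (fun _ : ι => H) →L[ℂ] PiLp 2 (fun _ : ι => H)) :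
    matrixOperator (operatorBlocks X) = X := by
  ext x i
  have hx : x = ∑ j, PiLp.single 2 j (x j) := by
    ext k
    simp [Pi.single_apply]
  conv_rhs => rw [hx]
  simp only [matrixOperator_apply, map_sum, WithLp.ofLp_sum, Finset.sum_apply]
  rfl

lemma norm_diagonalOperator_le (a : H →L[ℂ] H) : ‖diagonalOperator ι a‖ ≤ ‖a‖ := by
  refine ContinuousLinearMap.opNorm_le_bound _ (norm_nonneg _) fun x => ?_
  refine le_of_sq_le_sq ?_ (by positivity)
  rw [mul_pow, PiLp.norm_sq_eq_of_L2, PiLp.norm_sq_eq_of_L2, Finset.mul_sum]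
  refine Finset.sum_le_sum fun i _ => ?_
  rw [← mul_pow, diagonalOperator_apply]
  gcongr
  exact a.le_opNorm _

lemma matrixOperator_map_jordanElementary (a b : H →L[ℂ] H) (M : CStarMatrix ι ι (H →L[ℂ] H)) :
    matrixOperator (M.map (jordanElementary a b)) =
      diagonalOperator ι a * matrixOperator M * diagonalOperator ι b +
        diagonalOperator ι b * matrixOperator M * diagonalOperator ι a := by
  ext x i
  simp [jordanElementary, Finset.sum_add_distrib]

variable [CompleteSpace H]

/-- `matrixOperator` as a star homomorphism of C⋆-algebras. -/
noncomputable def matrixOperatorHom :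
    CStarMatrix ι ι (H →L[ℂ] H) →⋆ₙₐ[ℂ]
      (PiLp 2 (fun _ : ι => H) →L[ℂ] PiLp 2 (fun _ : ι => H)) where
  toFun := matrixOperator
  map_smul' c M := by
    ext x i
    simp [Finset.smul_sum]
  map_zero' := by
    ext x i
    simp
  map_add' M N := by
    ext x i
    simp [Finset.sum_add_distrib]
  map_mul' M N := by
    ext x i
    simp only [matrixOperator_apply, CStarMatrix.mul_apply, sum_apply,
      mul_apply_eq_comp, map_sum]
    exact Finset.sum_comm
  map_star' M := by
    rw [ContinuousLinearMap.star_eq_adjoint, ContinuousLinearMap.eq_adjoint_iff]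
    intro x y
    simp only [PiLp.inner_apply, matrixOperator_apply, CStarMatrix.star_apply,
      ContinuousLinearMap.star_eq_adjoint, sum_inner, inner_sum,
      ContinuousLinearMap.adjoint_inner_left]
    exact Finset.sum_comm

/-- An injective star homomorphism of C⋆-algebras is isometric. -/
lemma norm_matrixOperator (M : CStarMatrix ι ι (H →L[ℂ] H)) : ‖matrixOperator M‖ = ‖M‖ := by
  classical
  exact NonUnitalStarAlgHom.norm_map (matrixOperatorHom (H := H) (ι := ι))
    (fun _ _ h => matrixOperator_injective h) M

lemma adjoint_diagonalOperator (a : H →L[ℂ] H) :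
    (diagonalOperator ι a)† = diagonalOperator ι (a†) := by
  symm
  rw [ContinuousLinearMap.eq_adjoint_iff]
  intro x y
  simp [PiLp.inner_apply, ContinuousLinearMap.adjoint_inner_left]

lemma norm_map_jordanElementary_le (a b : H →L[ℂ] H) (M : CStarMatrix ι ι (H →L[ℂ] H)) :
    ‖M.map (jordanElementary a b)‖ ≤ 2 * ‖a‖ * ‖b‖ * ‖M‖ := by
  rw [← norm_matrixOperator, ← norm_matrixOperator M, matrixOperator_map_jordanElementary]
  have key (c d : H →L[ℂ] H) :
      ‖diagonalOperator ι c * matrixOperator M * diagonalOperator ι d‖ ≤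
        ‖c‖ * ‖matrixOperator M‖ * ‖d‖ := by
    refine (norm_mul_le _ _).trans ?_
    gcongr
    · refine (norm_mul_le _ _).trans ?_
      gcongr
      exact norm_diagonalOperator_le c
    · exact norm_diagonalOperator_le d
  refine (norm_add_le _ _).trans ((add_le_add (key a b) (key b a)).trans_eq ?_)
  ring

lemma cbENorm_jordanElementary_le (a b : H →L[ℂ] H) :
    cbENorm (jordanElementary a b) ≤ ENNReal.ofReal (2 * ‖a‖ * ‖b‖) := by
  refine iSup_le fun n => iSup_le fun M => iSup_le fun hM => ENNReal.ofReal_le_ofReal ?_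
  exact (norm_map_jordanElementary_le a b M).trans (mul_le_of_le_one_right (by positivity) hM)

end CStarMatrixRepresentation

/-! ### Contractions exchanging two vectors -/

section Contraction

variable {K : Type*} [NormedAddCommGroup K] [InnerProductSpace ℂ K]

/-- Orthogonal pairs with equal norms are intertwined by a contraction. -/
lemma exists_contraction_of_orthogonal {u v u' v' : K} (huv : ⟪u, v⟫_ℂ = 0)
    (huv' : ⟪u', v'⟫_ℂ = 0) (hu : ‖u'‖ = ‖u‖) (hv : ‖v'‖ = ‖v‖) :
    ∃ X : K →L[ℂ] K, ‖X‖ ≤ 1 ∧ X u = u' ∧ X v = v' := by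
  have hvu : ⟪v, u⟫_ℂ = 0 := inner_eq_zero_symm.mp huv
  -- Coefficients of the orthogonal projection onto the span of `u` and `v`; division by zero gives
  -- `0` when a vector vanishes.
  let α : K → ℂ := fun y => ⟪u, y⟫_ℂ / (‖u‖ : ℂ) ^ 2
  let β : K → ℂ := fun y => ⟪v, y⟫_ℂ / (‖v‖ : ℂ) ^ 2
  let X : K →L[ℂ] K := ((‖u‖ : ℂ) ^ 2)⁻¹ • InnerProductSpace.rankOne ℂ u' u +
    ((‖v‖ : ℂ) ^ 2)⁻¹ • InnerProductSpace.rankOne ℂ v' v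
  have hX (y : K) : X y = α y • u' + β y • v' := by
    simp [X, α, β, smul_smul, div_eq_inv_mul]
  have pyth {x y : K} (h : ⟪x, y⟫_ℂ = 0) : ‖x + y‖ ^ 2 = ‖x‖ ^ 2 + ‖y‖ ^ 2 := by
    simpa only [sq] using norm_add_sq_eq_norm_sq_add_norm_sq_of_inner_eq_zero x y h
  have hαu (y : K) : α y * ⟪u, u⟫_ℂ = ⟪u, y⟫_ℂ := by
    rcases eq_or_ne u 0 with rfl | h
    · simp
    · have : (‖u‖ : ℂ) ≠ 0 := by simpa using h
      simp only [α, inner_self_eq_norm_sq_to_K]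
      exact div_mul_cancel₀ _ (pow_ne_zero _ this)
  have hβv (y : K) : β y * ⟪v, v⟫_ℂ = ⟪v, y⟫_ℂ := by
    rcases eq_or_ne v 0 with rfl | h
    · simp
    · have : (‖v‖ : ℂ) ≠ 0 := by simpa using h
      simp only [β, inner_self_eq_norm_sq_to_K]
      exact div_mul_cancel₀ _ (pow_ne_zero _ this)
  refine ⟨X, ContinuousLinearMap.opNorm_le_bound _ zero_le_one fun y => ?_, ?_, ?_⟩
  · have h1 : ‖X y‖ ^ 2 = ‖α y • u + β y • v‖ ^ 2 := by
      rw [hX, pyth (by simp [huv']), pyth (by simp [huv])]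
      simp [norm_smul, hu, hv]
    have h2 : ‖y‖ ^ 2 = ‖α y • u + β y • v‖ ^ 2 + ‖y - (α y • u + β y • v)‖ ^ 2 := by
      rw [← pyth, add_sub_cancel]
      simp only [inner_add_left, inner_smul_left, inner_sub_right, inner_add_right,
        inner_smul_right, huv, hvu, mul_zero, add_zero, zero_add]
      linear_combination (-(starRingEnd ℂ) (α y)) * hαu y - (starRingEnd ℂ) (β y) * hβv y
    rw [one_mul]
    refine le_of_sq_le_sq ?_ (norm_nonneg _)
    rw [h1, h2]
    exact le_add_of_nonneg_right (sq_nonneg _)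
  · rcases eq_or_ne u 0 with rfl | h
    · rw [map_zero, eq_comm, ← norm_eq_zero, hu, norm_zero]
    · have : (‖u‖ : ℂ) ≠ 0 := by simpa using h
      simp [hX, α, β, hvu, inner_self_eq_norm_sq_to_K, this]
  · rcases eq_or_ne v 0 with rfl | h
    · rw [map_zero, eq_comm, ← norm_eq_zero, hv, norm_zero]
    · have : (‖v‖ : ℂ) ≠ 0 := by simpa using h
      simp [hX, α, β, huv, inner_self_eq_norm_sq_to_K, this]

/-- Pairs of unit vectors with the same real inner product are exchanged by a contraction. -/
lemma exists_contraction_swap {p q p' q' : K} (hp : ‖p‖ = 1) (hq : ‖q‖ = 1)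
    (hp' : ‖p'‖ = 1) (hq' : ‖q'‖ = 1) {r : ℝ} (h : ⟪p, q⟫_ℂ = r) (h' : ⟪p', q'⟫_ℂ = r) :
    ∃ X : K →L[ℂ] K, ‖X‖ ≤ 1 ∧ X q = p' ∧ X p = q' := by
  have flip {x y : K} (h : ⟪x, y⟫_ℂ = r) : ⟪y, x⟫_ℂ = r := by
    rw [← inner_conj_symm, h, Complex.conj_ofReal]
  have self {x : K} (h : ‖x‖ = 1) : ⟪x, x⟫_ℂ = 1 := by
    rw [inner_self_eq_norm_sq_to_K, h]; simp
  have orth {x y : K} (hx : ‖x‖ = 1) (hy : ‖y‖ = 1) (h : ⟪x, y⟫_ℂ = r) :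
      ⟪x + y, x - y⟫_ℂ = 0 := by
    simp only [inner_add_left, inner_sub_right, h, flip h, self hx, self hy]
    ring
  have hadd : ‖p' + q'‖ = ‖p + q‖ := by
    rw [← sq_eq_sq₀ (norm_nonneg _) (norm_nonneg _), norm_add_sq (𝕜 := ℂ),
      norm_add_sq (𝕜 := ℂ), h, h', hp, hq, hp', hq']
  have hsub : ‖-(p' - q')‖ = ‖p - q‖ := by
    rw [norm_neg, ← sq_eq_sq₀ (norm_nonneg _) (norm_nonneg _), norm_sub_sq (𝕜 := ℂ),
      norm_sub_sq (𝕜 := ℂ), h, h', hp, hq, hp', hq']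
  -- Since `r` is real, `p + q` is orthogonal to `p - q`. Fixing the sign on sums and reversing it
  -- on differences produces the swap.
  obtain ⟨X, hX, hu, hv⟩ := exists_contraction_of_orthogonal (orth hp hq h)
    (by rw [inner_neg_right, orth hp' hq' h', neg_zero]) hadd hsub
  rw [map_add] at hu
  rw [map_sub] at hv
  have h2 : (2 : ℂ) ≠ 0 := two_ne_zero
  refine ⟨X, hX, ?_, ?_⟩
  · refine smul_right_injective K h2 ?_
    simp only
    linear_combination (norm := module) hu - hv
  · refine smul_right_injective K h2 ?_
    simp only
    linear_combination (norm := module) hu + hv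

/-- After normalization and a phase change, the swapping contraction attains Cauchy–Schwarz in both
terms at once. -/
lemma exists_contraction_norm_inner_add_inner {p q p' q' : K} (hp : ‖p'‖ = ‖p‖)
    (hq : ‖q'‖ = ‖q‖) (h : ⟪q', p'⟫_ℂ = ⟪p, q⟫_ℂ) :
    ∃ X : K →L[ℂ] K, ‖X‖ ≤ 1 ∧ ‖⟪p', X q⟫_ℂ + ⟪q', X p⟫_ℂ‖ = 2 * ‖p‖ * ‖q‖ := by
  rcases eq_or_ne p 0 with rfl | hp0
  · have : p' = 0 := by simpa using hp
    exact ⟨0, by simp [this]⟩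
  rcases eq_or_ne q 0 with rfl | hq0
  · exact ⟨0, by simp⟩
  -- By `h`, `⟪p', q'⟫` is the conjugate of `⟪p, q⟫`, so rotating `q` by `θ` and `q'` by its
  -- conjugate makes both the same real number.
  obtain ⟨θ, hθ, hr⟩ : ∃ θ : ℂ, ‖θ‖ = 1 ∧ θ * ⟪p, q⟫_ℂ = (‖⟪p, q⟫_ℂ‖ : ℝ) := by
    rcases eq_or_ne ⟪p, q⟫_ℂ 0 with h0 | h0
    · exact ⟨1, by simp [h0]⟩
    · have h1 : (‖⟪p, q⟫_ℂ‖ : ℂ) ≠ 0 := by simpa using h0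
      refine ⟨‖⟪p, q⟫_ℂ‖ / ⟪p, q⟫_ℂ, ?_, div_mul_cancel₀ _ h0⟩
      rw [norm_div, Complex.norm_real, norm_norm, div_self (by simpa using h0)]
  have hs : (‖p‖ : ℂ) ≠ 0 := by simpa using hp0
  have ht : (‖q‖ : ℂ) ≠ 0 := by simpa using hq0
  have hr' : (starRingEnd ℂ) θ * ⟪p', q'⟫_ℂ = (‖⟪p, q⟫_ℂ‖ : ℝ) := by
    rw [← inner_conj_symm, h, ← map_mul, hr, Complex.conj_ofReal]
  have hs' : ‖p‖ ≠ 0 := by simpa using hp0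
  have ht' : ‖q‖ ≠ 0 := by simpa using hq0
  obtain ⟨X, hX, h1, h2⟩ := exists_contraction_swap
    (p := (‖p‖ : ℂ)⁻¹ • p) (q := (θ / ‖q‖) • q)
    (p' := (‖p‖ : ℂ)⁻¹ • p') (q' := ((starRingEnd ℂ) θ / ‖q‖) • q')
    (r := ‖⟪p, q⟫_ℂ‖ / (‖p‖ * ‖q‖))
    (by simp [norm_smul, hs']) (by simp [norm_smul, hθ, ht']) (by simp [norm_smul, hp, hs'])
    (by simp [norm_smul, hq, hθ, ht'])
    (by
      rw [inner_smul_left, inner_smul_right, map_inv₀, Complex.conj_ofReal]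
      push_cast
      rw [← hr]
      field_simp)
    (by
      rw [inner_smul_left, inner_smul_right, map_inv₀, Complex.conj_ofReal]
      push_cast
      rw [← hr']
      field_simp)
  refine ⟨X, hX, ?_⟩
  rw [map_smul] at h1 h2
  have hθ0 : θ ≠ 0 := by
    rintro rfl
    simp at hθ
  have e1 := congrArg (fun z => ⟪p', z⟫_ℂ) h1
  have e2 := congrArg (fun z => ⟪q', z⟫_ℂ) h2
  simp only [inner_smul_right, inner_self_eq_norm_sq_to_K, hp, hq] at e1 e2
  have hθθ : θ * (starRingEnd ℂ) θ = 1 := by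
    rw [Complex.mul_conj, Complex.normSq_eq_norm_sq, hθ]; simp
  have hsum : θ * (⟪p', X q⟫_ℂ + ⟪q', X p⟫_ℂ) = 2 * ‖p‖ * ‖q‖ := by
    have e1' : θ * ⟪p', X q⟫_ℂ = ‖p‖ * ‖q‖ := by
      simp only [Complex.coe_algebraMap] at e1
      field_simp at e1
      linear_combination e1
    have e2' : ⟪q', X p⟫_ℂ = (starRingEnd ℂ) θ * (‖p‖ * ‖q‖) := by
      simp only [Complex.coe_algebraMap] at e2
      field_simp at e2
      linear_combination e2
    rw [mul_add, e1', e2']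
    linear_combination (‖p‖ * ‖q‖ : ℂ) * hθθ
  have := congrArg norm hsum
  rw [norm_mul, hθ, one_mul] at this
  simpa using this

end Contraction

/-! ### Operators as vectors of `Hⁿ` -/

section Vectorization

variable {H ι : Type*} [NormedAddCommGroup H] [InnerProductSpace ℂ H] [Fintype ι]

/-- The vector `(a eᵢ)ᵢ` of images of an orthonormal basis. -/
noncomputable def vectorization (e : OrthonormalBasis ι ℂ H) (a : H →L[ℂ] H) :
    PiLp 2 (fun _ : ι => H) :=
  WithLp.toLp 2 fun i => a (e i)

lemma norm_sq_vectorization_one (e : OrthonormalBasis ι ℂ H) :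
    ‖vectorization e 1‖ ^ 2 = Fintype.card ι := by
  simp [PiLp.norm_sq_eq_of_L2, vectorization]

lemma diagonalOperator_vectorization_one (e : OrthonormalBasis ι ℂ H) (a : H →L[ℂ] H) :
    diagonalOperator ι a (vectorization e 1) = vectorization e a := by
  ext i
  simp [vectorization]

variable [CompleteSpace H]

lemma inner_vectorization (e : OrthonormalBasis ι ℂ H) (a b : H →L[ℂ] H) :
    ⟪vectorization e a, vectorization e b⟫_ℂ =
      LinearMap.trace ℂ H ((star a * b : H →L[ℂ] H) : H →ₗ[ℂ] H) := by
  rw [LinearMap.trace_eq_sum_inner _ e]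
  simp [vectorization, PiLp.inner_apply, ContinuousLinearMap.star_eq_adjoint,
    ContinuousLinearMap.adjoint_inner_right]

lemma norm_vectorization (e : OrthonormalBasis ι ℂ H) (a : H →L[ℂ] H) :
    ‖vectorization e a‖ = hilbertSchmidtNorm a := by
  rw [hilbertSchmidtNorm, ← inner_vectorization e, @norm_eq_sqrt_re_inner ℂ]
  rfl

/-- Both sides are traces of the same product, taken in the two cyclic orders. -/
lemma inner_vectorization_star (e : OrthonormalBasis ι ℂ H) (a b : H →L[ℂ] H) :
    ⟪vectorization e (star b), vectorization e (star a)⟫_ℂ =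
      ⟪vectorization e a, vectorization e b⟫_ℂ := by
  rw [inner_vectorization, inner_vectorization, star_star]
  exact LinearMap.trace_mul_comm ℂ (b : H →ₗ[ℂ] H) ((star a : H →L[ℂ] H) : H →ₗ[ℂ] H)

lemma norm_vectorization_star (e : OrthonormalBasis ι ℂ H) (a : H →L[ℂ] H) :
    ‖vectorization e (star a)‖ = ‖vectorization e a‖ := by
  rw [@norm_eq_sqrt_re_inner ℂ, inner_vectorization_star, ← norm_eq_sqrt_re_inner]

lemma inner_vectorization_one_map_jordanElementary (e : OrthonormalBasis ι ℂ H)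
    (a b : H →L[ℂ] H) (M : CStarMatrix ι ι (H →L[ℂ] H)) :
    ⟪vectorization e 1, matrixOperator (M.map (jordanElementary a b)) (vectorization e 1)⟫_ℂ =
      ⟪vectorization e (star a), matrixOperator M (vectorization e b)⟫_ℂ +
        ⟪vectorization e (star b), matrixOperator M (vectorization e a)⟫_ℂ := by
  rw [matrixOperator_map_jordanElementary, add_apply, inner_add_right]
  simp only [mul_apply_eq_comp, diagonalOperator_vectorization_one]
  rw [← ContinuousLinearMap.adjoint_inner_left (diagonalOperator ι a),
    ← ContinuousLinearMap.adjoint_inner_left (diagonalOperator ι b), adjoint_diagonalOperator,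
    adjoint_diagonalOperator, diagonalOperator_vectorization_one,
    diagonalOperator_vectorization_one]
  rfl

end Vectorization

/-! ### The lower bound -/

/-- Some matrix contraction witnesses `2 ‖a‖₂ ‖b‖₂ ≤ (dim H) ‖T_{a,b}‖_cb`. -/
lemma exists_two_mul_hilbertSchmidtNorm_mul_le {H : Type*} [NormedAddCommGroup H]
    [InnerProductSpace ℂ H] [CompleteSpace H] {n : ℕ} (e : OrthonormalBasis (Fin n) ℂ H)
    (a b : H →L[ℂ] H) :
    ∃ M : CStarMatrix (Fin n) (Fin n) (H →L[ℂ] H), ‖M‖ ≤ 1 ∧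
      2 * hilbertSchmidtNorm a * hilbertSchmidtNorm b ≤
        n * ‖M.map (jordanElementary a b)‖ := by
  obtain ⟨X, hX, hab⟩ := exists_contraction_norm_inner_add_inner
    (norm_vectorization_star e a) (norm_vectorization_star e b) (inner_vectorization_star e a b)
  refine ⟨operatorBlocks X, ?_, ?_⟩
  · rwa [← norm_matrixOperator, matrixOperator_operatorBlocks]
  · rw [← norm_vectorization e, ← norm_vectorization e, ← hab]
    have h := inner_vectorization_one_map_jordanElementary e a b (operatorBlocks X)
    rw [matrixOperator_operatorBlocks] at h
    rw [← h, ← norm_matrixOperator]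
    set T := matrixOperator ((operatorBlocks X).map (jordanElementary a b))
    have hn : ‖vectorization e 1‖ ^ 2 = n := by simpa using norm_sq_vectorization_one e
    calc ‖⟪vectorization e 1, T (vectorization e 1)⟫_ℂ‖
        ≤ ‖vectorization e 1‖ * (‖T‖ * ‖vectorization e 1‖) :=
          (norm_inner_le_norm _ _).trans (by gcongr; exact T.le_opNorm _)
      _ = n * ‖T‖ := by rw [← hn]; ring

theorem theorem3p2 {H : Type*} [NormedAddCommGroup H] [InnerProductSpace ℂ H] [CompleteSpace H]
    (hH : Module.finrank ℂ H = 2) (a b : H →L[ℂ] H) :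
    IsCompletelyBounded (jordanElementary a b) ∧
      hilbertSchmidtNorm a * hilbertSchmidtNorm b ≤ cbNorm (jordanElementary a b) := by
  have hcb : cbENorm (jordanElementary a b) ≠ ⊤ :=
    ne_top_of_le_ne_top ENNReal.ofReal_ne_top (cbENorm_jordanElementary_le a b)
  refine ⟨hcb, ?_⟩
  have : FiniteDimensional ℂ H := Module.finite_of_finrank_eq_succ hH
  obtain ⟨M, hM, hab⟩ := exists_two_mul_hilbertSchmidtNorm_mul_le
    ((stdOrthonormalBasis ℂ H).reindex (finCongr hH)) a b
  have hle : ENNReal.ofReal ‖M.map (jordanElementary a b)‖ ≤ cbENorm (jordanElementary a b) :=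
    le_iSup_of_le 2 (le_iSup_of_le M (le_iSup_of_le hM le_rfl))
  have := (ENNReal.ofReal_le_iff_le_toReal hcb).mp hle
  push_cast at hab
  unfold cbNorm
  linarith
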